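/- Let $\mathcal H_A\simeq\mathcal H_B$ be finite-dimensional complex Hilbert spaces of the same dimension, with orthonormal bases $\{|i\rangle_A\}_{i\in I}$ and $\{|i\rangle_B\}_{i\in I}$ labelled by the same finite set $I$, and let $n\ge 0$ be an integer. Put $|\Gamma\rangle_{AB}=\sum_{i\in I}|i\rangle_A\otimes|i\rangle_B$ and $\Gamma_{AB}=|\Gamma\rangle\langle\Gamma|_{AB}$, and define the positive semi-definite operator $$R_n=\mathbb E_{U_B}\Big[(\mathbb 1_{A^n}\otimes U_B^{\otimes n})\,\Gamma_{AB}^{\otimes n}\,(\mathbb 1_{A^n}\otimes (U_B^\dagger)^{\otimes n})\Big]$$ on $(\mathcal H_A\otimes\mathcal H_B)^{\otimes n}\cong\mathcal H_A^{\otimes n}\otimes\mathcal H_B^{\otimes n}$, where $U_B$ is a random unitary on $\mathcal H_B$ distributed according to the Haar probability measure. An operator $X$ on $\mathcal H^{\otimes n}$ is called permutationally symmetric if $P_\pi X P_\pi^\dagger=X$ for all $\pi\in S_n$, where $P_\pi$ is the unitary that permutes the tensor factors according to $\pi$. A state is a positive semi-definite operator of trace one. (i) For all permutationally symmetric operators $X_{A^n}$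 on $\mathcal H_A^{\otimes n}$ and $Y_{B^n}$ on $\mathcal H_B^{\otimes n}$, the operator $R_n$ commutes with $X_{A^n}\otimes Y_{B^n}$. (ii) For every permutationally symmetric state $\rho_{A^n}$ on $\mathcal H_A^{\otimes n}$, $$(\sqrt{\rho_{A^n}}\otimes\mathbb 1_{B^n})\,R_n\,(\sqrt{\rho_{A^n}}\otimes\mathbb 1_{B^n})=\sqrt{R_n}\,(\rho_{A^n}\otimes\mathbb 1_{B^n})\,\sqrt{R_n}.$$ -/

import Mathlib

open MeasureTheory
open scoped Matrix Kronecker ComplexOrder MatrixOrder Matrix.Norms.L2Operator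

/-!
Operators on finite-dimensional Hilbert spaces are given by their matrices in fixed orthonormal
bases. The systems `A` and `B` both carry an orthonormal basis labelled by the finite type `ι`;
the `n`-fold tensor power of either has the product basis labelled by `Fin n → ι`, and
`A^n ⊗ B^n` has the product basis labelled by `(Fin n → ι) × (Fin n → ι)`.
-/

namespace RandomPurification

section TensorPower

variable {κ : Type*} [Fintype κ] [DecidableEq κ]

/-- The matrix of `M ⊗ ⋯ ⊗ M` (`n` factors) in the product basis. -/
def tensorPower (n : ℕ) (M : Matrix κ κ ℂ) : Matrix (Fin n → κ) (Fin n → κ) ℂ :=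
  Matrix.of fun x y => ∏ k, M (x k) (y k)

/-- The unitary `P_π` permuting the tensor factors: it sends the product basis vector
`|y₁ … yₙ⟩` to the one whose `π k`-th factor is `y k`. -/
def permUnitary {n : ℕ} (π : Equiv.Perm (Fin n)) : Matrix (Fin n → κ) (Fin n → κ) ℂ :=
  Matrix.of fun x y => if x = y ∘ π.symm then 1 else 0

/-- `X` is permutationally symmetric: `P_π X P_π† = X` for all permutations `π`. -/
def PermSymmetric {n : ℕ} (X : Matrix (Fin n → κ) (Fin n → κ) ℂ) : Prop :=
  ∀ π : Equiv.Perm (Fin n), permUnitary π * X * (permUnitary π)ᴴ = X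

/-- A quantum state (density operator): positive semi-definite with unit trace. -/
def IsState (ρ : Matrix κ κ ℂ) : Prop :=
  ρ.PosSemidef ∧ ρ.trace = 1

end TensorPower

section Haar

variable {ι : Type*} [Fintype ι] [DecidableEq ι]

/-- The Borel σ-algebra on the unitary group. -/
noncomputable instance measurableSpace_unitaryGroup : MeasurableSpace (Matrix.unitaryGroup ι ℂ) := borel _

instance borelSpace_unitaryGroup : BorelSpace (Matrix.unitaryGroup ι ℂ) := ⟨rfl⟩

instance compactSpace_unitaryGroup : CompactSpace (Matrix.unitaryGroup ι ℂ) := by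
  refine isCompact_iff_compactSpace.mp ?_
  refine IsCompact.of_isClosed_subset
    (isCompact_univ_pi fun _ => isCompact_univ_pi fun _ => isCompact_closedBall (0 : ℂ) 1)
    isClosed_unitary ?_
  intro U hU i _ j _
  simpa using entry_norm_bound_of_unitary hU i j

variable (ι) in
/-- The Haar probability measure on the unitary group. -/
noncomputable def haarUnitary : Measure (Matrix.unitaryGroup ι ℂ) :=
  Measure.haarMeasure ⊤

instance isProbabilityMeasure_haarUnitary : IsProbabilityMeasure (haarUnitary ι) :=
  ⟨Measure.haarMeasure_self⟩

variable (ι) in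
/-- The un-normalised maximally entangled vector `|Γ⟩ = ∑ i, |i⟩ ⊗ |i⟩`. -/
def gammaVec : ι × ι → ℂ := ∑ i, Pi.single (i, i) 1

variable (ι) in
/-- `Γ = |Γ⟩⟨Γ|`. -/
def Gamma : Matrix (ι × ι) (ι × ι) ℂ :=
  Matrix.vecMulVec (gammaVec ι) (star (gammaVec ι))

variable (ι) in
/-- `Γ^{⊗n}`, as an operator on `A^n ⊗ B^n`: the factors of `(A ⊗ B)^{⊗n}` are regrouped. -/
def gammaPower (n : ℕ) :
    Matrix ((Fin n → ι) × (Fin n → ι)) ((Fin n → ι) × (Fin n → ι)) ℂ :=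
  Matrix.reindex (Equiv.arrowProdEquivProdArrow (Fin n) (fun _ => ι) (fun _ => ι))
    (Equiv.arrowProdEquivProdArrow (Fin n) (fun _ => ι) (fun _ => ι)) (tensorPower n (Gamma ι))

/-- `(1 ⊗ U^{⊗n}) Γ^{⊗n} (1 ⊗ (U†)^{⊗n})`. -/
def twirlIntegrand (n : ℕ) (U : Matrix ι ι ℂ) :
    Matrix ((Fin n → ι) × (Fin n → ι)) ((Fin n → ι) × (Fin n → ι)) ℂ :=
  ((1 : Matrix (Fin n → ι) (Fin n → ι) ℂ) ⊗ₖ tensorPower n U) * gammaPower ι n *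
    ((1 : Matrix (Fin n → ι) (Fin n → ι) ℂ) ⊗ₖ tensorPower n Uᴴ)

variable (ι) in
/-- `R_n`, the expectation (entry by entry) of `(1 ⊗ U^{⊗n}) Γ^{⊗n} (1 ⊗ (U†)^{⊗n})` over a
Haar-random unitary `U` on `B`. -/
noncomputable def Rop (n : ℕ) :
    Matrix ((Fin n → ι) × (Fin n → ι)) ((Fin n → ι) × (Fin n → ι)) ℂ :=
  Matrix.of fun p q => ∫ U : Matrix.unitaryGroup ι ℂ, twirlIntegrand n (U : Matrix ι ι ℂ) p q
    ∂(haarUnitary ι)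

/-- `R_n` is positive semi-definite, so that its square root is the genuine one. -/
theorem Rop_posSemidef (n : ℕ) : (Rop ι n).PosSemidef := by
  have hadj : ∀ U : Matrix ι ι ℂ, (tensorPower n U)ᴴ = tensorPower n Uᴴ := by
    intro U
    ext x y
    simp [tensorPower, Matrix.conjTranspose_apply]
  have hG : (gammaPower ι n).PosSemidef := by
    have h : gammaPower ι n = Matrix.vecMulVec (fun p => ∏ k, gammaVec ι (p.1 k, p.2 k))
        (star fun p => ∏ k, gammaVec ι (p.1 k, p.2 k)) := by
      ext p q
      simp [gammaPower, tensorPower, Gamma, Matrix.vecMulVec_apply, Finset.prod_mul_distrib,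
        Equiv.arrowProdEquivProdArrow]
    rw [h]
    exact Matrix.posSemidef_vecMulVec_self_star _
  have hpos : ∀ U : Matrix ι ι ℂ, (twirlIntegrand n U).PosSemidef := by
    intro U
    have h := hG.mul_mul_conjTranspose_same
      ((1 : Matrix (Fin n → ι) (Fin n → ι) ℂ) ⊗ₖ tensorPower n U)
    rwa [Matrix.conjTranspose_kronecker, Matrix.conjTranspose_one, hadj] at h
  have hcont : ∀ p q, Continuous fun U : Matrix.unitaryGroup ι ℂ =>
      twirlIntegrand n (U : Matrix ι ι ℂ) p q := by
    intro p q
    have h1 : ∀ i j, Continuous fun U : Matrix.unitaryGroup ι ℂ => (U : Matrix ι ι ℂ) i j :=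
      fun i j => continuous_subtype_val.matrix_elem i j
    simp only [twirlIntegrand, Matrix.mul_apply, Matrix.kroneckerMap_apply, tensorPower,
      Matrix.of_apply, Matrix.conjTranspose_apply]
    refine continuous_finsetSum _ fun j _ => (continuous_finsetSum _ fun k _ => ?_).mul ?_
    · exact (continuous_const.mul (continuous_finsetProd _ fun _ _ => h1 _ _)).mul continuous_const
    · exact continuous_const.mul (continuous_finsetProd _ fun _ _ => (h1 _ _).star)
  have hint : ∀ p q, Integrable (fun U : Matrix.unitaryGroup ι ℂ =>
      twirlIntegrand n (U : Matrix ι ι ℂ) p q) (haarUnitary ι) := fun p q =>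
    (hcont p q).integrable_of_hasCompactSupport (HasCompactSupport.of_compactSpace _)
  refine Matrix.PosSemidef.of_dotProduct_mulVec_nonneg ?_ ?_
  · ext p q
    simp only [Rop, Matrix.conjTranspose_apply, Matrix.of_apply, RCLike.star_def]
    rw [← integral_conj]
    refine integral_congr_ae (Filter.Eventually.of_forall fun U => ?_)
    exact (hpos U).1.apply p q
  · intro x
    have h : star x ⬝ᵥ (Rop ι n).mulVec x = ∫ U : Matrix.unitaryGroup ι ℂ,
        star x ⬝ᵥ (twirlIntegrand n (U : Matrix ι ι ℂ)).mulVec x ∂(haarUnitary ι) := by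
      simp only [dotProduct, Matrix.mulVec, Rop, Matrix.of_apply]
      rw [integral_finsetSum]
      · refine Finset.sum_congr rfl fun p _ => ?_
        rw [integral_const_mul, integral_finsetSum]
        · exact congrArg _ (Finset.sum_congr rfl fun q _ => (integral_mul_const _ _).symm)
        · exact fun q _ => (hint p q).mul_const _
      · exact fun p _ => (integrable_finsetSum _ fun q _ => (hint p q).mul_const _).const_mul _
    rw [h]
    exact integral_nonneg fun U => (hpos U).dotProduct_mulVec_nonneg x

end Haar

end RandomPurification

/-! ### Multisets of indices and the unitary trick -/

namespace RandomPurification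

/-! The vector `(1 ⊗ U^{⊗n})|Γ⟩^{⊗n}` is the vectorisation of `U^{⊗n}`, so `V^{⊗n} ⊗ W^{⊗n}` sends
it to that of `(W U Vᵀ)^{⊗n}`. Haar measure is invariant on both sides, hence `R_n` commutes with
every `V^{⊗n} ⊗ W^{⊗n}`, `V` and `W` unitary. These products span all `X ⊗ Y` with `X`, `Y`
symmetric (`PermSymmetric.mem_span_tensorPower`), which gives (i): a functional killing all `U^{⊗n}`
is a polynomial in the entries of `U` vanishing on unitaries, hence zero, and its coefficients
determine the functional on symmetric operators. Part (ii) follows because square roots inherit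
commutation. -/

/-- Two tuples whose values occur with the same multiplicities differ by a permutation. -/
theorem exists_perm_of_sum_single_eq {σ : Type*} {n : ℕ} {f g : Fin n → σ}
    (h : ∑ k, Finsupp.single (f k) 1 = ∑ k, Finsupp.single (g k) (1 : ℕ)) :
    ∃ π : Equiv.Perm (Fin n), f = g ∘ π := by
  classical
  have hcard : ∀ s, Nonempty ({k // f k = s} ≃ {k // g k = s}) := by
    intro s
    have hs := DFunLike.congr_fun h s
    simp only [Finsupp.coe_finsetSum, Finset.sum_apply, Finsupp.single_apply, Finset.sum_boole,
      Nat.cast_id] at hs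
    exact ⟨Fintype.equivOfCardEq (by simpa [Fintype.card_subtype] using hs)⟩
  -- Glue the bijections between corresponding fibres into one permutation.
  let e := fun s => (hcard s).some
  refine ⟨(Equiv.sigmaFiberEquiv f).symm.trans
    ((Equiv.sigmaCongrRight e).trans (Equiv.sigmaFiberEquiv g)), ?_⟩
  funext k
  exact (e (f k) ⟨k, rfl⟩).2.symm

/-- The unitary trick: a polynomial in the matrix entries that vanishes on all unitary matrices
is zero. -/
theorem mvPolynomial_eq_zero_of_eval_unitary {κ : Type*} [Fintype κ] [DecidableEq κ]
    (p : MvPolynomial (κ × κ) ℂ)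
    (h : ∀ U ∈ Matrix.unitaryGroup κ ℂ, MvPolynomial.eval (fun e => U e.1 e.2) p = 0) :
    p = 0 := by
  have hherm : ∀ H : Matrix κ κ ℂ, H.IsHermitian →
      MvPolynomial.eval (fun e => H e.1 e.2) p = 0 := by
    intro H hH
    set V := hH.eigenvectorUnitary
    -- In the eigenbasis of `H`, `p` becomes a polynomial in the eigenvalues. It vanishes on the
    -- torus `|d k| = 1`, a product of infinite sets, hence everywhere.
    let q : MvPolynomial κ ℂ := MvPolynomial.bind₁ (fun e : κ × κ =>
      ∑ k, MvPolynomial.C ((V : Matrix κ κ ℂ) e.1 k * star ((V : Matrix κ κ ℂ) e.2 k)) *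
        MvPolynomial.X k) p
    have hq : ∀ d : κ → ℂ, MvPolynomial.eval d q = MvPolynomial.eval
        (fun e => ((V : Matrix κ κ ℂ) * Matrix.diagonal d * (V : Matrix κ κ ℂ)ᴴ) e.1 e.2) p := by
      intro d
      simp only [q, MvPolynomial.eval, MvPolynomial.eval₂Hom_bind₁]
      congr 2
      funext e
      simp only [map_sum, map_mul, MvPolynomial.eval₂Hom_C, MvPolynomial.eval₂Hom_X',
        RingHom.id_apply]
      rw [Matrix.mul_apply]
      simp only [Matrix.mul_diagonal, Matrix.conjTranspose_apply]
      exact Finset.sum_congr rfl fun k _ => by ring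
    have hq0 : q = 0 := by
      refine MvPolynomial.funext_set (fun _ => Metric.sphere (0 : ℂ) 1) (fun _ => ?_)
        fun d hd => ?_
      · exact (isPreconnected_sphere (by simp) (0 : ℂ) 1).infinite_of_nontrivial
          ⟨1, by simp, -1, by simp, by norm_num⟩
      · rw [hq, map_zero]
        refine h _ (mul_mem (mul_mem V.2 ?_) (star V).2)
        rw [Matrix.mem_unitaryGroup_iff, Matrix.star_eq_conjTranspose,
          Matrix.diagonal_conjTranspose, Matrix.diagonal_mul_diagonal, ← Matrix.diagonal_one]
        congr 1
        funext k
        have hk : ‖d k‖ = 1 := by simpa using hd k trivial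
        simp [Complex.mul_conj, Complex.normSq_eq_norm_sq, hk]
    have hs := hH.spectral_theorem
    rw [Unitary.conjStarAlgAut_apply] at hs
    have := hq (RCLike.ofReal ∘ hH.eigenvalues)
    rw [hq0, map_zero] at this
    rw [hs]
    exact this.symm
  refine MvPolynomial.funext fun x => ?_
  rw [map_zero]
  let M : Matrix κ κ ℂ := Matrix.of fun i j => x (i, j)
  let A : Matrix κ κ ℂ := realPart M
  let B : Matrix κ κ ℂ := imaginaryPart M
  -- On the line `A + z B` the matrix is Hermitian for real `z`, so `q` has infinitely many roots;
  -- `z = i` then recovers `M`.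
  let q : Polynomial ℂ := MvPolynomial.aeval (fun e : κ × κ =>
    Polynomial.C (A e.1 e.2) + Polynomial.X * Polynomial.C (B e.1 e.2)) p
  have hq : ∀ z : ℂ, q.eval z = MvPolynomial.eval (fun e => (A + z • B) e.1 e.2) p := by
    intro z
    simp only [q, ← Polynomial.coe_evalRingHom, MvPolynomial.aeval_def, MvPolynomial.hom_eval₂]
    simp only [MvPolynomial.eval, MvPolynomial.coe_eval₂Hom]
    congr 1
    · ext c; simp
    · funext e
      simp [mul_comm z]
  have hq0 : q = 0 := by
    refine Polynomial.eq_zero_of_infinite_isRoot q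
      ((Set.infinite_range_of_injective Complex.ofReal_injective).mono ?_)
    rintro _ ⟨t, rfl⟩
    rw [Set.mem_ofPred_eq, Polynomial.IsRoot, hq]
    refine hherm _ (Matrix.IsHermitian.add (realPart M).2 ?_)
    have hB : Bᴴ = B := (imaginaryPart M).2
    rw [Matrix.IsHermitian, Matrix.conjTranspose_smul, hB]
    simp
  have hM : A + Complex.I • B = M := realPart_add_I_smul_imaginaryPart M
  have := hq Complex.I
  rw [hM, hq0, Polynomial.eval_zero] at this
  exact this.symm

/-! ### Tensor powers and permutation symmetry -/

theorem tensorPower_mul {κ : Type*} [Fintype κ] {n : ℕ} (M N : Matrix κ κ ℂ) :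
    tensorPower n (M * N) = tensorPower n M * tensorPower n N := by
  ext x y
  simp [tensorPower, Matrix.mul_apply, Finset.prod_univ_sum, Finset.prod_mul_distrib]

theorem tensorPower_one {κ : Type*} [DecidableEq κ] {n : ℕ} :
    tensorPower n (1 : Matrix κ κ ℂ) = 1 := by
  ext x y
  simp [tensorPower, Matrix.one_apply, Finset.prod_ite_zero, funext_iff]

theorem tensorPower_conjTranspose {κ : Type*} {n : ℕ} (M : Matrix κ κ ℂ) :
    (tensorPower n M)ᴴ = tensorPower n Mᴴ := by
  ext x y
  simp [tensorPower, Matrix.conjTranspose_apply]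

section TensorPower

variable {κ : Type*} [Fintype κ] [DecidableEq κ] {n : ℕ}

theorem permUnitary_mul_mul_conjTranspose_apply (π : Equiv.Perm (Fin n))
    (X : Matrix (Fin n → κ) (Fin n → κ) ℂ) (x y : Fin n → κ) :
    (permUnitary π * X * (permUnitary π)ᴴ : Matrix _ _ ℂ) x y = X (x ∘ π) (y ∘ π) := by
  have hπ : ∀ a b : Fin n → κ, a = b ∘ π.symm ↔ b = a ∘ π := fun a b =>
    ⟨fun h => by rw [h, Function.comp_assoc]; simp,
      fun h => by rw [h, Function.comp_assoc]; simp⟩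
  simp [Matrix.mul_apply, permUnitary, hπ, Matrix.conjTranspose_apply, apply_ite]

theorem PermSymmetric.apply_comp {X : Matrix (Fin n → κ) (Fin n → κ) ℂ} (hX : PermSymmetric X)
    (π : Equiv.Perm (Fin n)) (x y : Fin n → κ) : X (x ∘ π) (y ∘ π) = X x y := by
  exact (permUnitary_mul_mul_conjTranspose_apply π X x y).symm.trans (by rw [hX π])

/-- The permutationally symmetric operators are spanned by the tensor powers of unitaries. -/
theorem PermSymmetric.mem_span_tensorPower {X : Matrix (Fin n → κ) (Fin n → κ) ℂ}
    (hX : PermSymmetric X) :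
    X ∈ Submodule.span ℂ (tensorPower n '' (Matrix.unitaryGroup κ ℂ : Set (Matrix κ κ ℂ))) := by
  by_contra hXS
  obtain ⟨f, hfX, hfS⟩ := Submodule.exists_le_ker_of_notMem hXS
  apply hfX
  have hf : ∀ Z, f Z = ∑ w : (Fin n → κ) × (Fin n → κ),
      Z w.1 w.2 * f (Matrix.single w.1 w.2 1) := by
    intro Z
    conv_lhs => rw [Matrix.matrix_eq_sum_single Z]
    simp only [map_sum, Fintype.sum_prod_type]
    refine Finset.sum_congr rfl fun x _ => Finset.sum_congr rfl fun y _ => ?_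
    rw [← mul_one (Z x y), ← smul_eq_mul, ← Matrix.smul_single, map_smul]
    simp
  -- `m w` is the exponent of the monomial `∏ k, U (w.1 k) (w.2 k)`, so that `p` evaluates at `U` to
  -- `f (tensorPower n U)`.
  let m : (Fin n → κ) × (Fin n → κ) → (κ × κ →₀ ℕ) := fun w =>
    ∑ k, Finsupp.single (w.1 k, w.2 k) 1
  let p : MvPolynomial (κ × κ) ℂ := ∑ w, MvPolynomial.monomial (m w) (f (Matrix.single w.1 w.2 1))
  have hp : p = 0 := by
    refine mvPolynomial_eq_zero_of_eval_unitary p fun U hU => ?_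
    have hU0 : f (tensorPower n U) = 0 := hfS (Submodule.subset_span ⟨U, hU, rfl⟩)
    rw [← hU0, hf, map_sum]
    refine Finset.sum_congr rfl fun w _ => ?_
    rw [MvPolynomial.eval_monomial, mul_comm]
    congr 1
    simp only [m]
    rw [← Finsupp.prod_finsetSum_index (by simp) (by simp [pow_add])]
    simp [tensorPower]
  have hcoeff : ∀ c, ∑ w with m w = c, f (Matrix.single w.1 w.2 1) = 0 := by
    intro c
    have := congrArg (MvPolynomial.coeff c) hp
    simpa [p, MvPolynomial.coeff_sum, MvPolynomial.coeff_monomial, Finset.sum_filter] using this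
  have hconst : ∀ w v, m w = m v → X w.1 w.2 = X v.1 v.2 := by
    intro w v hwv
    obtain ⟨π, hπ⟩ := exists_perm_of_sum_single_eq hwv
    have h1 : w.1 = v.1 ∘ π := funext fun k => congrArg Prod.fst (congrFun hπ k)
    have h2 : w.2 = v.2 ∘ π := funext fun k => congrArg Prod.snd (congrFun hπ k)
    rw [h1, h2, hX.apply_comp]
  -- On each fibre of `m` the entry of `X` is constant, and what remains is a coefficient of `p`.
  rw [hf, ← Finset.sum_fiberwise_of_maps_to (t := Finset.univ.image m) (g := m)
    (fun w _ => Finset.mem_image_of_mem m (Finset.mem_univ w))]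
  refine Finset.sum_eq_zero fun c hc => ?_
  obtain ⟨v, -, rfl⟩ := Finset.mem_image.mp hc
  rw [Finset.sum_congr rfl fun w hw => by
    rw [hconst w v (Finset.mem_filter.mp hw).2], ← Finset.mul_sum, hcoeff, mul_zero]

theorem tensorPower_mem_unitaryGroup {U : Matrix κ κ ℂ} (hU : U ∈ Matrix.unitaryGroup κ ℂ) :
    tensorPower n U ∈ Matrix.unitaryGroup (Fin n → κ) ℂ := by
  rw [Matrix.mem_unitaryGroup_iff, Matrix.star_eq_conjTranspose] at hU ⊢
  rw [tensorPower_conjTranspose, ← tensorPower_mul, hU, tensorPower_one]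

theorem permUnitary_mem_unitaryGroup (π : Equiv.Perm (Fin n)) :
    (permUnitary π : Matrix (Fin n → κ) (Fin n → κ) ℂ) ∈ Matrix.unitaryGroup (Fin n → κ) ℂ := by
  rw [Matrix.mem_unitaryGroup_iff, Matrix.star_eq_conjTranspose]
  ext x y
  have h := permUnitary_mul_mul_conjTranspose_apply π (1 : Matrix (Fin n → κ) _ ℂ) x y
  rw [mul_one] at h
  rw [h]
  simp [Matrix.one_apply, π.surjective.injective_comp_right.eq_iff]

theorem permSymmetric_iff_commute {X : Matrix (Fin n → κ) (Fin n → κ) ℂ} :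
    PermSymmetric X ↔ ∀ π : Equiv.Perm (Fin n), Commute (permUnitary π) X := by
  refine forall_congr' fun π => ?_
  have h := permUnitary_mem_unitaryGroup (κ := κ) π
  have h1 := Matrix.mem_unitaryGroup_iff.mp h
  have h2 := Matrix.mem_unitaryGroup_iff'.mp h
  rw [Matrix.star_eq_conjTranspose] at h1 h2
  constructor
  · intro hX
    have := congrArg (· * permUnitary π) hX
    simpa [mul_assoc, h2, Commute, SemiconjBy] using this
  · intro hX
    rw [hX.eq, mul_assoc, h1, mul_one]

/-- Functional calculus preserves commutation with each `P_π`. If `X` is not positive semi-definite,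
the root is the default value 0. -/
theorem PermSymmetric.sqrt {X : Matrix (Fin n → κ) (Fin n → κ) ℂ} (hX : PermSymmetric X) :
    PermSymmetric (CFC.sqrt X) := by
  rw [permSymmetric_iff_commute] at hX ⊢
  exact fun π => ((hX π).symm.cfcₙ_nnreal _).symm

theorem PermSymmetric.one : PermSymmetric (1 : Matrix (Fin n → κ) (Fin n → κ) ℂ) :=
  permSymmetric_iff_commute.mpr fun _ => Commute.one_right _

end TensorPower

/-! ### Haar averaging and the commutant -/

section Haar

variable {ι : Type*} [Fintype ι] [DecidableEq ι]

instance isHaarMeasure_haarUnitary : (haarUnitary ι).IsHaarMeasure :=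
  inferInstanceAs (Measure.haarMeasure ⊤).IsHaarMeasure

/-- A right translate of Haar measure is again a left-invariant probability measure, so uniqueness
applies. -/
instance isMulRightInvariant_haarUnitary : (haarUnitary ι).IsMulRightInvariant := by
  refine ⟨fun g => ?_⟩
  have : IsProbabilityMeasure (Measure.map (· * g) (haarUnitary ι)) :=
    Measure.isProbabilityMeasure_map (continuous_mul_const g).aemeasurable
  exact Measure.isHaarMeasure_eq_of_isProbabilityMeasure _ _

/-- `(1 ⊗ U^{⊗n}) |Γ⟩^{⊗n}`. -/
def twirlVec (n : ℕ) (U : Matrix ι ι ℂ) : (Fin n → ι) × (Fin n → ι) → ℂ :=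
  fun p => tensorPower n U p.2 p.1

theorem gammaPower_apply {n : ℕ} (p q : (Fin n → ι) × (Fin n → ι)) :
    gammaPower ι n p q = if p.1 = p.2 ∧ q.1 = q.2 then 1 else 0 := by
  have hg : ∀ i j : ι, gammaVec ι (i, j) = if i = j then 1 else 0 := by
    intro i j
    simp only [gammaVec, Finset.sum_apply, Pi.single_apply, Prod.mk.injEq]
    rcases eq_or_ne i j with rfl | hij
    · simp
    · rw [if_neg hij]
      exact Finset.sum_eq_zero fun k _ => if_neg fun h => hij (h.1.trans h.2.symm)
  have hstar : ∀ P : Prop, [Decidable P] → star (if P then 1 else 0 : ℂ) = if P then 1 else 0 := by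
    intro P _
    split_ifs <;> simp
  simp only [gammaPower, tensorPower, Gamma, Matrix.vecMulVec_apply, hg, hstar, Pi.star_apply,
    Matrix.reindex_apply, Matrix.submatrix_apply, Matrix.of_apply, Finset.prod_mul_distrib,
    Equiv.arrowProdEquivProdArrow, Equiv.coe_fn_symm_mk, Finset.prod_ite_zero, funext_iff]
  simp [← ite_and, and_comm]

theorem twirlIntegrand_eq (n : ℕ) (U : Matrix ι ι ℂ) :
    twirlIntegrand n U = Matrix.vecMulVec (twirlVec n U) (star (twirlVec n U)) := by
  ext p q
  rw [twirlIntegrand, ← tensorPower_conjTranspose]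
  simp [Matrix.mul_apply, gammaPower_apply, twirlVec, Matrix.vecMulVec_apply,
    Fintype.sum_prod_type, Matrix.one_apply, ite_and]

/-- Under vectorisation, acting on `B` is left multiplication and acting on `A` is right
multiplication by the transpose. -/
theorem kronecker_tensorPower_mulVec_twirlVec {ι : Type*} [Fintype ι] (n : ℕ)
    (U V W : Matrix ι ι ℂ) :
    (tensorPower n V ⊗ₖ tensorPower n W) *ᵥ twirlVec n U = twirlVec n (W * U * Vᵀ) := by
  ext p
  rw [twirlVec, tensorPower_mul, tensorPower_mul]
  simp only [Matrix.mulVec, dotProduct, Matrix.kroneckerMap_apply, Fintype.sum_prod_type,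
    Matrix.mul_apply, Finset.sum_mul]
  refine Finset.sum_congr rfl fun a _ => Finset.sum_congr rfl fun b _ => ?_
  simp only [twirlVec, tensorPower, Matrix.of_apply, Matrix.transpose_apply]
  ring

theorem kronecker_tensorPower_conj_twirlIntegrand (n : ℕ) (U V W : Matrix ι ι ℂ) :
    (tensorPower n V ⊗ₖ tensorPower n W) * twirlIntegrand n U *
      (tensorPower n V ⊗ₖ tensorPower n W)ᴴ = twirlIntegrand n (W * U * Vᵀ) := by
  rw [twirlIntegrand_eq, twirlIntegrand_eq, Matrix.mul_vecMulVec, Matrix.vecMulVec_mul,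
    ← Matrix.star_mulVec, kronecker_tensorPower_mulVec_twirlVec]

theorem integrable_twirlIntegrand (n : ℕ) (p q : (Fin n → ι) × (Fin n → ι)) :
    Integrable (fun U : Matrix.unitaryGroup ι ℂ => twirlIntegrand n (U : Matrix ι ι ℂ) p q)
      (haarUnitary ι) := by
  have h1 : ∀ i j, Continuous fun U : Matrix.unitaryGroup ι ℂ => (U : Matrix ι ι ℂ) i j :=
    fun i j => continuous_subtype_val.matrix_elem i j
  refine Continuous.integrable_of_hasCompactSupport ?_ (HasCompactSupport.of_compactSpace _)
  simp only [twirlIntegrand_eq, Matrix.vecMulVec_apply, twirlVec, tensorPower, Matrix.of_apply,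
    Pi.star_apply]
  exact (continuous_finsetProd _ fun _ _ => h1 _ _).mul
    (continuous_finsetProd _ fun _ _ => h1 _ _).star

theorem mul_Rop_mul_apply {n : ℕ}
    (K L : Matrix ((Fin n → ι) × (Fin n → ι)) ((Fin n → ι) × (Fin n → ι)) ℂ)
    (p q : (Fin n → ι) × (Fin n → ι)) :
    (K * Rop ι n * L) p q = ∫ U : Matrix.unitaryGroup ι ℂ,
      (K * twirlIntegrand n (U : Matrix ι ι ℂ) * L) p q ∂(haarUnitary ι) := by
  have hint := integrable_twirlIntegrand (ι := ι) n
  simp only [Matrix.mul_apply, Rop, Matrix.of_apply]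
  rw [integral_finsetSum]
  · refine Finset.sum_congr rfl fun j _ => ?_
    rw [integral_mul_const, integral_finsetSum]
    · simp only [integral_const_mul]
    · exact fun i _ => (hint i j).const_mul _
  · exact fun j _ => (integrable_finsetSum _ fun i _ => (hint i j).const_mul _).mul_const _

theorem kronecker_mem_unitaryGroup {κ κ' : Type*} [Fintype κ] [DecidableEq κ] [Fintype κ']
    [DecidableEq κ'] {V : Matrix κ κ ℂ} {W : Matrix κ' κ' ℂ} (hV : V ∈ Matrix.unitaryGroup κ ℂ)
    (hW : W ∈ Matrix.unitaryGroup κ' ℂ) : V ⊗ₖ W ∈ Matrix.unitaryGroup (κ × κ') ℂ := by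
  rw [Matrix.mem_unitaryGroup_iff, Matrix.star_eq_conjTranspose] at hV hW ⊢
  rw [Matrix.conjTranspose_kronecker, ← Matrix.mul_kronecker_mul, hV, hW, Matrix.one_kronecker_one]

theorem transpose_mem_unitaryGroup {V : Matrix ι ι ℂ} (hV : V ∈ Matrix.unitaryGroup ι ℂ) :
    Vᵀ ∈ Matrix.unitaryGroup ι ℂ := by
  rw [Matrix.mem_unitaryGroup_iff', Matrix.star_eq_conjTranspose] at hV
  rw [Matrix.mem_unitaryGroup_iff, Matrix.star_eq_conjTranspose]
  have := congrArg Matrix.transpose hV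
  rwa [Matrix.transpose_mul, Matrix.transpose_one] at this

theorem commute_Rop_kronecker_tensorPower (n : ℕ) {V W : Matrix ι ι ℂ}
    (hV : V ∈ Matrix.unitaryGroup ι ℂ) (hW : W ∈ Matrix.unitaryGroup ι ℂ) :
    Commute (Rop ι n) (tensorPower n V ⊗ₖ tensorPower n W) := by
  set K := tensorPower n V ⊗ₖ tensorPower n W with hK
  have hconj : K * Rop ι n * Kᴴ = Rop ι n := by
    ext p q
    rw [mul_Rop_mul_apply]
    simp only [hK, kronecker_tensorPower_conj_twirlIntegrand, Rop, Matrix.of_apply]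
    let F : Matrix.unitaryGroup ι ℂ → ℂ := fun U => twirlIntegrand n (U : Matrix ι ι ℂ) p q
    have h1 := integral_mul_right_eq_self (μ := haarUnitary ι)
      (fun U => F (⟨W, hW⟩ * U)) ⟨Vᵀ, transpose_mem_unitaryGroup hV⟩
    have h2 := integral_mul_left_eq_self (μ := haarUnitary ι) F ⟨W, hW⟩
    simpa only [F, Submonoid.coe_mul, mul_assoc] using h1.trans h2
  have hKu := Matrix.mem_unitaryGroup_iff'.mp (kronecker_mem_unitaryGroup
    (tensorPower_mem_unitaryGroup (n := n) hV) (tensorPower_mem_unitaryGroup (n := n) hW))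
  rw [Matrix.star_eq_conjTranspose, ← hK] at hKu
  calc Rop ι n * K = K * Rop ι n * (Kᴴ * K) := by rw [← mul_assoc, hconj]
    _ = K * Rop ι n := by rw [hKu, mul_one]

theorem commute_Rop_kronecker {n : ℕ} {X Y : Matrix (Fin n → ι) (Fin n → ι) ℂ}
    (hX : PermSymmetric X) (hY : PermSymmetric Y) : Commute (Rop ι n) (X ⊗ₖ Y) := by
  have hXs := hX.mem_span_tensorPower
  have hYs := hY.mem_span_tensorPower
  clear hX hY
  induction hXs, hYs using Submodule.span_induction₂ with
  | mem_mem X Y hX hY =>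
    obtain ⟨V, hV, rfl⟩ := hX
    obtain ⟨W, hW, rfl⟩ := hY
    exact commute_Rop_kronecker_tensorPower n hV hW
  | zero_left => simp
  | zero_right => simp
  | add_left X X' Y _ _ _ h h' => rw [Matrix.add_kronecker]; exact h.add_right h'
  | add_right X Y Y' _ _ _ h h' => rw [Matrix.kronecker_add]; exact h.add_right h'
  | smul_left r X Y _ _ h => rw [Matrix.smul_kronecker]; exact h.smul_right r
  | smul_right r X Y _ _ h => rw [Matrix.kronecker_smul]; exact h.smul_right r

end Haar

end RandomPurification

theorem mainTheorem5 {ι : Type*} [Fintype ι] [DecidableEq ι] (n : ℕ) :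
    (∀ X Y : Matrix (Fin n → ι) (Fin n → ι) ℂ,
      RandomPurification.PermSymmetric X → RandomPurification.PermSymmetric Y →
        Commute (RandomPurification.Rop ι n) (X ⊗ₖ Y)) ∧
    (∀ ρ : Matrix (Fin n → ι) (Fin n → ι) ℂ,
      RandomPurification.IsState ρ → RandomPurification.PermSymmetric ρ →
        (CFC.sqrt ρ ⊗ₖ (1 : Matrix (Fin n → ι) (Fin n → ι) ℂ)) * RandomPurification.Rop ι n *
            (CFC.sqrt ρ ⊗ₖ (1 : Matrix (Fin n → ι) (Fin n → ι) ℂ)) =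
          CFC.sqrt (RandomPurification.Rop ι n) *
            (ρ ⊗ₖ (1 : Matrix (Fin n → ι) (Fin n → ι) ℂ)) *
            CFC.sqrt (RandomPurification.Rop ι n)) := by
  open RandomPurification in
  refine ⟨fun X Y hX hY => commute_Rop_kronecker hX hY, fun ρ hρ hsym => ?_⟩
  have hR : CFC.sqrt (Rop ι n) * CFC.sqrt (Rop ι n) = Rop ι n :=
    CFC.sqrt_mul_sqrt_self _ (Rop_posSemidef n).nonneg
  have hρρ : CFC.sqrt ρ * CFC.sqrt ρ = ρ := CFC.sqrt_mul_sqrt_self _ hρ.1.nonneg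
  have h1 := commute_Rop_kronecker hsym.sqrt PermSymmetric.one
  have h2 : Commute (CFC.sqrt (Rop ι n)) (ρ ⊗ₖ (1 : Matrix (Fin n → ι) (Fin n → ι) ℂ)) :=
    (commute_Rop_kronecker hsym PermSymmetric.one).cfcₙ_nnreal _
  -- Both sides reduce to `(ρ ⊗ 1) R_n`.
  rw [← h1.eq, mul_assoc, ← Matrix.mul_kronecker_mul, hρρ, mul_one, ← h2.eq.symm, mul_assoc,
    hR, (commute_Rop_kronecker hsym PermSymmetric.one).eq]
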